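/- **Setting.** Let $n\in\mathbb N$ and let $C=(C_{ij})$ be an $n\times n$ matrix with entries in $\{0,1,2,\dots\}\cup\{\infty\}$. Let $A=D_n\cong\mathbb C^n$ be the algebra of diagonal matrices, with minimal projections $e_1,\dots,e_n$. Let $E(C)$ be the W*-correspondence over $A$ of all matrices $\xi=(\xi_{ij})$ with $\xi_{ij}\in\mathbb C^{C_{ij}}$ (where $\mathbb C^\infty=\ell^2$), with $(\xi D)_{ij}=\xi_{ij}d_j$, $(\varphi(D)\xi)_{ij}=d_i\xi_{ij}$ and $\langle\xi,\eta\rangle_j=\sum_i\langle\xi_{ij},\eta_{ij}\rangle$. Let $\mathcal F(E(C))=A\oplus E(C)\oplus E(C)^{\otimes 2}\oplus\cdots$ be its full Fock space, a Hilbert W*-module over $A$; let $\mathcal L(\mathcal F(E(C)))$ be the von Neumann algebra of adjointable operators on it, $T_\xi\eta=\xi\otimes\eta$ the creation operators ($\xi\in E(C)$), and $\varphi_\infty$ the left action of $A$ on $\mathcal F(E(C))$. The quiver algebra $\mathcal T_+(C)$ is the norm closed subalgebra of $\mathcal L(\mathcal F(E(C)))$ generated by all $T_\xi$ and $\varphi_\infty(A)$,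 and $H^\infty(C)$ is its $w^*$-closure in $\mathcal L(\mathcal F(E(C)))$. For the $1\times1$ matrix $(m)$ these algebras are the noncommutative disc algebra $\mathcal A_m=\mathcal T_+((m))$ and the free semigroup algebra $\mathcal L_m=H^\infty((m))$. Subalgebras of $\mathcal L(\mathcal F(E(C)))$ carry the relative $w^*$-topology and the matrix norms inherited from the C*-algebras $M_k(\mathcal L(\mathcal F(E(C))))$. **Proposition.** For every $1\le i\le n$ with $C_{ii}\ne0$ there is a (not necessarily unital) algebra homomorphism $$\Psi_i:\mathcal L_{C_{ii}}\to H^\infty(C)$$ that is completely isometric and is a homeomorphism onto its image for the $w^*$-topologies, and that restricts to a completely isometric homomorphism of $\mathcal A_{C_{ii}}$ into $\mathcal T_+(C)$. Moreover $\Psi_i(I)=\varphi_\infty(e_i)$, and $\Psi_i(T_x)=T_{\xi}$ for every $x\in\mathbb C^{C_{ii}}$, where $\xi\in E(C)$ has $(i,i)$ entry $x$ and all other entries $0$. -/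

import Mathlib

open scoped ComplexOrder

set_option linter.unusedSectionVars false

noncomputable section

namespace QuiverAlgebra

/-! ### Adjointable operators on a Hilbert C⋆-module -/

section Adjointable

variable (A E : Type*) [CStarAlgebra A] [PartialOrder A] [StarOrderedRing A]
  [NormedAddCommGroup E] [NormedSpace ℂ E] [SMul A E] [CStarModule A E]

/-- `𝓛(E)`: the algebra of the bounded operators `T` on the Hilbert C⋆-module `E` which have an
adjoint for the `A`-valued inner product.  (Such operators are automatically module maps.) -/
def adjointable : Subalgebra ℂ (E →L[ℂ] E) where
  carrier := {T | ∃ S : E →L[ℂ] E, ∀ x y : E, inner A (T x) y = inner A x (S y)}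
  mul_mem' := by
    rintro T₁ T₂ ⟨S₁, h₁⟩ ⟨S₂, h₂⟩
    exact ⟨S₂ * S₁, fun x y => by simp [h₁, h₂]⟩
  add_mem' := by
    rintro T₁ T₂ ⟨S₁, h₁⟩ ⟨S₂, h₂⟩
    exact ⟨S₁ + S₂, fun x y => by simp [h₁, h₂]⟩
  algebraMap_mem' := by
    intro c
    refine ⟨algebraMap ℂ _ (star c), fun x y => ?_⟩
    simp [Algebra.algebraMap_eq_smul_one]

variable {A E}

theorem eq_of_forall_inner {x y : E} (h : ∀ z : E, inner A z x = inner A z y) : x = y := by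
  have : inner A (x - y) (x - y) = 0 := by
    rw [CStarModule.inner_sub_right, h, sub_self]
  exact sub_eq_zero.1 (CStarModule.inner_self.1 this)

namespace adjointable

instance : NormedRing (adjointable A E) := inferInstance
instance : NormedAlgebra ℂ (adjointable A E) := inferInstance
instance : NormedSpace ℂ (adjointable A E) := inferInstance

/-- The adjoint of an adjointable operator. -/
instance : Star (adjointable A E) where
  star T := ⟨T.2.choose, T.1, fun x y => by
    rw [← CStarModule.star_inner, ← T.2.choose_spec, CStarModule.star_inner]⟩

theorem inner_left (T : adjointable A E) (x y : E) :
    inner A (T.1 x) y = inner A x ((star T).1 y) :=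
  T.2.choose_spec x y

theorem inner_right (T : adjointable A E) (x y : E) :
    inner A x (T.1 y) = inner A ((star T).1 x) y := by
  rw [← CStarModule.star_inner, inner_left, CStarModule.star_inner]

theorem star_eq_of {T S : adjointable A E}
    (h : ∀ x y : E, inner A (T.1 x) y = inner A x (S.1 y)) : star T = S := by
  apply Subtype.ext
  ext y
  refine eq_of_forall_inner (A := A) fun z => ?_
  rw [← inner_left, h]

instance : StarRing (adjointable A E) where
  star_involutive T := star_eq_of fun x y => (inner_right T x y).symm
  star_mul S T := star_eq_of fun x y => by
    change inner A (S.1 (T.1 x)) y = inner A x ((star T).1 ((star S).1 y))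
    rw [inner_left, inner_left]
  star_add S T := star_eq_of fun x y => by
    change inner A (S.1 x + T.1 x) y = inner A x ((star S).1 y + (star T).1 y)
    rw [CStarModule.inner_add_left, CStarModule.inner_add_right, inner_left, inner_left]

instance : StarModule ℂ (adjointable A E) where
  star_smul c T := star_eq_of fun x y => by
    change inner A (c • T.1 x) y = inner A x (star c • (star T).1 y)
    rw [CStarModule.inner_smul_left_complex, CStarModule.inner_smul_right_complex, inner_left]

instance : CStarRing (adjointable A E) where
  norm_mul_self_le T := by
    have key : ∀ x : E, ‖T.1 x‖ ≤ √‖star T * T‖ * ‖x‖ := by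
      intro x
      refine abs_le_of_sq_le_sq' ?_ (by positivity) |>.2
      rw [mul_pow, Real.sq_sqrt (norm_nonneg _), CStarModule.norm_sq_eq A, inner_left]
      refine (CStarModule.norm_inner_le E).trans ?_
      have h := (star T * T).1.le_opNorm x
      calc ‖x‖ * ‖(star T).1 (T.1 x)‖ ≤ ‖x‖ * (‖star T * T‖ * ‖x‖) := by
            gcongr; exact h
        _ = ‖star T * T‖ * ‖x‖ ^ 2 := by ring
    have h := T.1.opNorm_le_bound (by positivity) key
    change ‖T.1‖ * ‖T.1‖ ≤ _
    calc ‖T.1‖ * ‖T.1‖ ≤ √‖star T * T‖ * √‖star T * T‖ := by gcongr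
      _ = ‖star T * T‖ := Real.mul_self_sqrt (norm_nonneg _)

theorem isClosed [CompleteSpace E] : IsClosed (adjointable A E : Set (E →L[ℂ] E)) := by
  refine IsSeqClosed.isClosed fun T T₀ hT hlim => ?_
  let T' : ℕ → adjointable A E := fun n => ⟨T n, hT n⟩
  have hc : CauchySeq fun n => (star (T' n)).1 := by
    have h := hlim.cauchySeq
    rw [Metric.cauchySeq_iff] at h ⊢
    intro ε hε
    obtain ⟨N, hN⟩ := h ε hε
    refine ⟨N, fun m hm n hn => ?_⟩
    have := hN m hm n hn
    rw [dist_eq_norm] at this ⊢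
    have e : ‖(star (T' m)).1 - (star (T' n)).1‖ = ‖star (T' m - T' n)‖ := by
      rw [star_sub]; rfl
    rw [e, norm_star]
    exact this
  obtain ⟨S, hS⟩ := cauchySeq_tendsto_of_complete hc
  refine ⟨S, fun x y => ?_⟩
  have h1 : Filter.Tendsto (fun n => inner A (T n x) y) Filter.atTop (nhds (inner A (T₀ x) y)) := by
    have hx : Filter.Tendsto (fun n => T n x) Filter.atTop (nhds (T₀ x)) :=
      ((ContinuousLinearMap.apply ℂ E x).continuous.tendsto _).comp hlim
    have hf : Continuous fun z : E => inner A z y :=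
      CStarModule.continuous_inner.comp (continuous_id.prodMk continuous_const)
    exact (hf.tendsto _).comp hx
  have h2 : Filter.Tendsto (fun n => inner A x ((star (T' n)).1 y)) Filter.atTop
      (nhds (inner A x (S y))) := by
    have hy : Filter.Tendsto (fun n => (star (T' n)).1 y) Filter.atTop (nhds (S y)) :=
      ((ContinuousLinearMap.apply ℂ E y).continuous.tendsto _).comp hS
    have hf : Continuous fun z : E => inner A x z :=
      CStarModule.continuous_inner.comp (continuous_const.prodMk continuous_id)
    exact (hf.tendsto _).comp hy
  refine tendsto_nhds_unique h1 (h2.congr fun n => ?_)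
  exact (inner_left (T' n) x y).symm

instance [CompleteSpace E] : CStarAlgebra (adjointable A E) where
  toCompleteSpace := isClosed.completeSpace_coe

/-- The usual order of a C⋆-algebra, used only to have Mathlib's C⋆-norm on matrices over it. -/
instance [CompleteSpace E] : PartialOrder (adjointable A E) := CStarAlgebra.spectralOrder _

instance [CompleteSpace E] : StarOrderedRing (adjointable A E) :=
  CStarAlgebra.spectralOrderedRing _

end adjointable

end Adjointable

/-! ### The weak-⋆ topology of `𝓛(E)`, for `E` over the diagonal algebra `V → ℂ` -/

section WeakStar

variable {V : Type*} [Fintype V]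
  (E : Type*) [NormedAddCommGroup E] [NormedSpace ℂ E] [SMul (V → ℂ) E] [CStarModule (V → ℂ) E]

/-- The predual of `𝓛(E)`: the norm closed linear span, in the dual of `𝓛(E)`, of the functionals
`T ↦ ⟪x, T y⟫_j`; here `j` runs through the coordinate functionals, which span the predual of the
algebra `V → ℂ`. -/
def predual : Submodule ℂ (StrongDual ℂ (adjointable (V → ℂ) E)) :=
  (Submodule.span ℂ {ω | ∃ (j : V) (x y : E),
    ∀ T : adjointable (V → ℂ) E, ω T = inner (V → ℂ) x (T.1 y) j}).topologicalClosure

/-- The weak-⋆ topology `σ(𝓛(E), 𝓛(E)_*)` on `𝓛(E)`. -/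
@[reducible] def wstarTopology : TopologicalSpace (adjointable (V → ℂ) E) :=
  TopologicalSpace.induced (fun T (ω : predual (V := V) E) => ω.1 T) inferInstance

variable {E}

theorem predual_comp {Φ : adjointable (V → ℂ) E →L[ℂ] adjointable (V → ℂ) E}
    (h : ∀ (j : V) (x y : E), ∃ x' y' : E, ∀ T : adjointable (V → ℂ) E,
      inner (V → ℂ) x ((Φ T).1 y) j = inner (V → ℂ) x' (T.1 y') j)
    (ω : predual (V := V) E) : ω.1.comp Φ ∈ predual (V := V) E := by
  let R : StrongDual ℂ (adjointable (V → ℂ) E) →L[ℂ] StrongDual ℂ (adjointable (V → ℂ) E) :=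
    (ContinuousLinearMap.compL ℂ (adjointable (V → ℂ) E) (adjointable (V → ℂ) E) ℂ).flip Φ
  have : predual (V := V) E ≤ (predual (V := V) E).comap R.toLinearMap := by
    refine Submodule.topologicalClosure_minimal _ (Submodule.span_le.2 ?_) ?_
    · rintro ω ⟨j, x, y, hω⟩
      obtain ⟨x', y', h'⟩ := h j x y
      refine Submodule.le_topologicalClosure _ (Submodule.subset_span ⟨j, x', y', fun T => ?_⟩)
      rw [← h', ← hω]
      rfl
    · exact (Submodule.isClosed_topologicalClosure _).preimage R.continuous
  exact this ω.2

theorem continuous_wstar_of (Φ : adjointable (V → ℂ) E →L[ℂ] adjointable (V → ℂ) E)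
    (h : ∀ (j : V) (x y : E), ∃ x' y' : E, ∀ T : adjointable (V → ℂ) E,
      inner (V → ℂ) x ((Φ T).1 y) j = inner (V → ℂ) x' (T.1 y') j) :
    @Continuous _ _ (wstarTopology (V := V) E) (wstarTopology E) (fun T => Φ T) := by
  have h1 : ∀ ω : predual (V := V) E, ∃ ω' : predual (V := V) E, ∀ T, ω.1 (Φ T) = ω'.1 T :=
    fun ω => ⟨⟨ω.1.comp Φ, predual_comp h ω⟩, fun T => rfl⟩
  refine continuous_induced_rng.2 (@continuous_pi _ _ _ (wstarTopology E) _ _ fun ω => ?_)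
  obtain ⟨ω', hω'⟩ := h1 ω
  have h2 : @Continuous _ _ (wstarTopology (V := V) E) _
      fun T (ω : predual (V := V) E) => ω.1 T := continuous_induced_dom
  have h3 := @Continuous.comp _ _ _ (wstarTopology (V := V) E) _ _ _ _ (continuous_apply ω') h2
  convert h3 using 2 with T
  exact hω' T

theorem semitopological_wstar :
    @IsSemitopologicalSemiring (adjointable (V → ℂ) E) (wstarTopology (V := V) E) _ := by
  let F : adjointable (V → ℂ) E →+ (predual (V := V) E → ℂ) :=
    { toFun := fun T ω => ω.1 T
      map_zero' := by ext; simp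
      map_add' := fun S T => by ext; simp }
  have hl : ∀ S : adjointable (V → ℂ) E, @Continuous _ _ (wstarTopology (V := V) E)
      (wstarTopology (V := V) E) (fun T => S * T) := fun S =>
    continuous_wstar_of (ContinuousLinearMap.mul ℂ _ S) fun j x y =>
      ⟨(star S).1 x, y, fun T => by rw [← adjointable.inner_right]; rfl⟩
  have hr : ∀ S : adjointable (V → ℂ) E, @Continuous _ _ (wstarTopology (V := V) E)
      (wstarTopology (V := V) E) (fun T => T * S) := fun S =>
    continuous_wstar_of ((ContinuousLinearMap.mul ℂ _).flip S) fun j x y =>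
      ⟨x, S.1 y, fun T => rfl⟩
  have hadd : @ContinuousAdd (adjointable (V → ℂ) E) (wstarTopology (V := V) E) _ :=
    continuousAdd_induced F
  let := wstarTopology (V := V) E
  exact { hadd with
    continuous_const_mul := fun {S} => hl S
    continuous_mul_const := fun {S} => hr S }

/-- The weak-⋆ closure of a subalgebra of `𝓛(E)`. -/
def wstarClosure (B : Subalgebra ℂ (adjointable (V → ℂ) E)) :
    Subalgebra ℂ (adjointable (V → ℂ) E) :=
  @Subalgebra.topologicalClosure ℂ _ (adjointable (V → ℂ) E) _ (wstarTopology (V := V) E) _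
    semitopological_wstar B

/-- The relative weak-⋆ topology on a subalgebra of `𝓛(E)`. -/
@[reducible] def wstarTopologyOn (B : Subalgebra ℂ (adjointable (V → ℂ) E)) : TopologicalSpace B :=
  (wstarTopology (V := V) E).induced Subtype.val

end WeakStar

/-- A map between subalgebras of `𝓛(E)` and `𝓛(E')` is completely isometric if for every `k` it is
isometric entrywise on `k × k` matrices, for the norms of the C⋆-algebras `M_k(𝓛(E))` and
`M_k(𝓛(E'))`. -/
def CompletelyIsometric {A E A' E' : Type*}
    [CStarAlgebra A] [PartialOrder A] [StarOrderedRing A] [NormedAddCommGroup E]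
    [NormedSpace ℂ E] [SMul A E] [CStarModule A E] [CompleteSpace E]
    [CStarAlgebra A'] [PartialOrder A'] [StarOrderedRing A'] [NormedAddCommGroup E']
    [NormedSpace ℂ E'] [SMul A' E'] [CStarModule A' E'] [CompleteSpace E']
    {B : Subalgebra ℂ (adjointable A E)} {B' : Subalgebra ℂ (adjointable A' E')}
    (f : B → B') : Prop :=
  ∀ (k : ℕ) (M : Matrix (Fin k) (Fin k) B),
    ‖CStarMatrix.ofMatrix (M.map fun S => (f S : adjointable A' E'))‖ =
      ‖CStarMatrix.ofMatrix (M.map fun S => (S : adjointable A E))‖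

/-! ### Hilbert modules of matrices of `ℓ²` vectors -/

section MatrixModule

variable {V : Type*} [Fintype V]

/-- The Hilbert space of the `j`-th columns `(ξ i)_i`, with `ξ i ∈ ℓ²(X i j)`. -/
abbrev Column (X : V → V → Type*) (j : V) : Type _ :=
  PiLp 2 fun i : V => lp (fun _ : X i j => ℂ) 2

/-- The space of all `V × V` matrices with `(i, j)` entry in `ℓ²(X i j)`, written column by column:
the `(i, j)` entry of `ξ` is `ξ j i`.  Its norm is `max_j (∑ i, ‖ξ j i‖²)^(1/2)`.  The diagonal
algebra `V → ℂ` acts on the right by `(ξ D)_{ij} = d_j ξ_{ij}`; this commutative algebra is made to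
act on the left in Lean (`(D • ξ) j = D j • ξ j`), as in Mathlib's Hilbert C⋆-modules. -/
abbrev MatrixModule (X : V → V → Type*) : Type _ := ∀ j : V, Column X j

/-- The `(V → ℂ)`-valued inner product `⟪ξ, η⟫_j = ∑ i, ⟪ξ_{ij}, η_{ij}⟫`, linear in `η`. -/
instance (X : V → V → Type*) : CStarModule (V → ℂ) (MatrixModule X) where
  inner ξ η := fun j => inner ℂ (ξ j) (η j)
  inner_add_right := by intros; ext j; simp
  inner_self_nonneg := by
    intro x j
    have h : inner ℂ (x j) (x j) = ((‖x j‖ ^ 2 : ℝ) : ℂ) := by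
      rw [inner_self_eq_norm_sq_to_K]; norm_cast
    change (0 : ℂ) ≤ inner ℂ (x j) (x j)
    rw [h]
    exact_mod_cast sq_nonneg ‖x j‖
  inner_self := by
    intro x
    constructor
    · intro h
      ext1 j
      exact inner_self_eq_zero.1 (congrFun h j)
    · rintro rfl
      ext j
      simp
  inner_op_smul_right := by
    intro a x y
    ext j
    exact inner_smul_right _ _ _
  inner_smul_right_complex := by
    intro z x y
    ext j
    exact inner_smul_right _ _ _
  star_inner x y := by
    ext j
    exact inner_conj_symm _ _
  norm_eq_sqrt_norm_inner_self x := by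
    have h : ∀ j, ‖inner ℂ (x j) (x j)‖ = ‖x j‖ ^ 2 := fun j => by
      rw [inner_self_eq_norm_sq_to_K]; simp
    apply le_antisymm
    · refine (pi_norm_le_iff_of_nonneg (Real.sqrt_nonneg _)).2 fun j => ?_
      refine Real.le_sqrt_of_sq_le ?_
      rw [← h j]
      exact norm_le_pi_norm (fun j => inner ℂ (x j) (x j)) j
    · refine Real.sqrt_le_iff.2 ⟨norm_nonneg _, ?_⟩
      refine (pi_norm_le_iff_of_nonneg (by positivity)).2 fun j => ?_
      rw [h j]
      gcongr
      exact norm_le_pi_norm x j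

/-- The adjointable operator that acts on the `j`-th column by `T j`. -/
def ofColumns {X : V → V → Type*} (T : ∀ j, Column X j →L[ℂ] Column X j) :
    adjointable (V → ℂ) (MatrixModule X) :=
  ⟨ContinuousLinearMap.pi fun j => T j ∘L ContinuousLinearMap.proj j,
    ContinuousLinearMap.pi fun j => ContinuousLinearMap.adjoint (T j) ∘L ContinuousLinearMap.proj j,
    fun x y => by
      ext j
      exact (ContinuousLinearMap.adjoint_inner_right (T j) (x j) (y j)).symm⟩

end MatrixModule

/-! ### The correspondence of a quiver and its Fock space -/

section Fock

variable {V : Type*} [Fintype V]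

/-- A set with `c` elements, countably infinite if `c = ∞`. -/
abbrev EdgeIndex (c : ℕ∞) : Type := {k : ℕ // (k : ℕ∞) < c}

/-- The paths of the quiver with arrow sets `X i l` (an element of `X i l` is an arrow from `l` to
`i`), written as words from left to right: `cons e₁ (cons e₂ (⋯ (nil j)))` with `e₁ ∈ X i l₁`,
`e₂ ∈ X l₁ l₂`, … is a path from `j` to `i`. -/
inductive PathOf {V : Type*} (X : V → V → Type) : V → V → Type _
  | nil (i : V) : PathOf X i i
  | cons {i l j : V} (e : X i l) (p : PathOf X l j) : PathOf X i j

/-- The paths from `j` to `i` in the quiver with `C i l` arrows from `l` to `i`. -/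
abbrev QPath (C : Matrix V V ℕ∞) : V → V → Type _ := PathOf fun i l => EdgeIndex (C i l)

/-- The correspondence `E(C)`: matrices with `(i, j)` entry in `ℂ^{C i j} = ℓ²(C i j)`. -/
abbrev Corr (C : Matrix V V ℕ∞) : Type _ := MatrixModule fun i j => EdgeIndex (C i j)

/-- The full Fock space `𝓕(E(C)) = ⨁ₖ E(C)^{⊗k}`.  The `(i, j)` entry of `E(C)^{⊗k}` is
`⨁ E(C)_{i l₁} ⊗ E(C)_{l₁ l₂} ⊗ ⋯ ⊗ E(C)_{l_{k-1} j}`, the sum over `l₁, …, l_{k-1}`, which has the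
paths of length `k` from `j` to `i` as orthonormal basis (for `k = 0` it is the `(i, j)` entry of
the diagonal algebra). -/
abbrev Fock (C : Matrix V V ℕ∞) : Type _ := MatrixModule (QPath C)

variable {C : Matrix V V ℕ∞}

/-- The coordinates of `ξ ⊗ η`, for `η` in the `j`-th column of the Fock space:
`(ξ ⊗ η)_{ij} = ∑ l, ξ_{il} ⊗ η_{lj}`. -/
def tensorCoord (ξ : Corr C) {j : V} (η : Column (QPath C) j) : ∀ i : V, QPath C i j → ℂ
  | _, .nil _ => 0
  | _, .cons (i := i) (l := l) e p => ξ l i e * η l p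

/-- Prepending an arrow to a path. -/
def consPath (i j : V) (x : Σ l : V, EdgeIndex (C i l) × QPath C l j) : QPath C i j :=
  .cons x.2.1 x.2.2

theorem consPath_injective (i j : V) : Function.Injective (consPath (C := C) i j) := by
  rintro ⟨l, e, p⟩ ⟨l', e', p'⟩ h
  simp only [consPath, PathOf.cons.injEq] at h
  obtain ⟨rfl, h1, h2⟩ := h
  rw [heq_eq_eq] at h1 h2
  rw [h1, h2]

theorem hasSum_sq {X : Type*} (f : lp (fun _ : X => ℂ) 2) :
    HasSum (fun x => ‖f x‖ ^ 2) (‖f‖ ^ 2) := by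
  have h := lp.hasSum_norm (p := 2) (by norm_num) f
  simpa using h

theorem hasSum_mul_of_nonneg {X Y : Type*} {a : X → ℝ} {b : Y → ℝ} {s t : ℝ}
    (ha : HasSum a s) (hb : HasSum b t) (ha' : 0 ≤ a) (hb' : 0 ≤ b) :
    HasSum (fun x : X × Y => a x.1 * b x.2) (s * t) :=
  ha.mul hb (ha.summable.mul_of_nonneg hb.summable ha' hb')

theorem hasSum_sq_mul {X Y : Type*} (f : lp (fun _ : X => ℂ) 2) (g : lp (fun _ : Y => ℂ) 2) :
    HasSum (fun x : X × Y => ‖f x.1‖ ^ 2 * ‖g x.2‖ ^ 2) (‖f‖ ^ 2 * ‖g‖ ^ 2) :=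
  hasSum_mul_of_nonneg (a := fun x => ‖f x‖ ^ 2) (b := fun y => ‖g y‖ ^ 2) (hasSum_sq f)
    (hasSum_sq g) (fun _ => sq_nonneg _) (fun _ => sq_nonneg _)

theorem hasSum_tensorCoord (ξ : Corr C) {j : V} (η : Column (QPath C) j) (i : V) :
    HasSum (fun p => ‖tensorCoord ξ η i p‖ ^ 2) (∑ l, ‖ξ l i‖ ^ 2 * ‖η l‖ ^ 2) := by
  rw [← (consPath_injective i j).hasSum_iff]
  · have h : ∀ l : V, HasSum (fun x : EdgeIndex (C i l) × QPath C l j =>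
        ‖ξ l i x.1‖ ^ 2 * ‖η l x.2‖ ^ 2) (‖ξ l i‖ ^ 2 * ‖η l‖ ^ 2) := fun l =>
      hasSum_sq_mul (ξ l i) (η l)
    have h' : Summable fun x : Σ l : V, EdgeIndex (C i l) × QPath C l j =>
        ‖ξ x.1 i x.2.1‖ ^ 2 * ‖η x.1 x.2.2‖ ^ 2 :=
      (summable_sigma_of_nonneg fun _ => by positivity).2
        ⟨fun l => (h l).summable, Summable.of_finite⟩
    have h'' := h'.hasSum.sigma h
    rw [(hasSum_fintype _).unique h'']
    convert h'.hasSum using 2 with x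
    simp [consPath, tensorCoord, mul_pow]
  · rintro (_ | ⟨e, p⟩) hx
    · simp [tensorCoord]
    · exact absurd ⟨⟨_, e, p⟩, rfl⟩ hx

/-- The vector `ξ ⊗ η`, for `η` in the `j`-th column of the Fock space. -/
def tensorVec (ξ : Corr C) {j : V} (η : Column (QPath C) j) : Column (QPath C) j :=
  WithLp.toLp 2 fun i => ⟨tensorCoord ξ η i, memℓp_gen (by
    simpa using (hasSum_tensorCoord ξ η i).summable)⟩

theorem norm_tensorVec_le (ξ : Corr C) {j : V} (η : Column (QPath C) j) :
    ‖tensorVec ξ η‖ ≤ ‖ξ‖ * ‖η‖ := by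
  refine abs_le_of_sq_le_sq' ?_ (by positivity) |>.2
  have h : ∀ i, ‖tensorVec ξ η i‖ ^ 2 = ∑ l, ‖ξ l i‖ ^ 2 * ‖η l‖ ^ 2 := fun i =>
    (hasSum_sq (tensorVec ξ η i)).unique (hasSum_tensorCoord ξ η i)
  rw [PiLp.norm_sq_eq_of_L2, mul_pow, PiLp.norm_sq_eq_of_L2 _ η]
  simp only [h]
  rw [Finset.sum_comm, Finset.mul_sum]
  refine Finset.sum_le_sum fun l _ => ?_
  rw [← Finset.sum_mul, ← PiLp.norm_sq_eq_of_L2]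
  gcongr
  exact norm_le_pi_norm ξ l

/-- The creation operator `T_ξ η = ξ ⊗ η` on the Fock space. -/
def creation (ξ : Corr C) : adjointable (V → ℂ) (Fock C) :=
  ofColumns fun j => LinearMap.mkContinuous
    { toFun := fun η : Column (QPath C) j => tensorVec ξ η
      map_add' := fun η ζ => by
        ext i p
        cases p with
        | nil => exact (add_zero (0 : ℂ)).symm
        | cons e p => exact mul_add _ _ _
      map_smul' := fun c η => by
        ext i p
        cases p with
        | nil => exact (mul_zero c).symm
        | cons e p => exact mul_left_comm _ _ _ }
    ‖ξ‖ (fun η => norm_tensorVec_le ξ η)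

/-- The left action `φ_∞` of the diagonal algebra on the Fock space: `(φ_∞(D) η)_{ij} = d_i η_{ij}`.
-/
def leftAction (C : Matrix V V ℕ∞) (D : V → ℂ) : adjointable (V → ℂ) (Fock C) :=
  ofColumns fun j =>
    let e := PiLp.continuousLinearEquiv 2 ℂ fun i : V => lp (fun _ : QPath C i j => ℂ) 2
    e.symm.toContinuousLinearMap ∘L
      (ContinuousLinearMap.pi fun i => D i • ContinuousLinearMap.proj i) ∘L e.toContinuousLinearMap

/-- The quiver algebra `𝒯₊(C)`: the norm closed subalgebra of `𝓛(𝓕(E(C)))` generated by all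
creation operators and by the left action of the diagonal algebra. -/
def quiverAlgebra (C : Matrix V V ℕ∞) : Subalgebra ℂ (adjointable (V → ℂ) (Fock C)) :=
  (Algebra.adjoin ℂ (Set.range (creation (C := C)) ∪
    Set.range (leftAction C))).topologicalClosure

/-- The algebra `H^∞(C)`: the weak-⋆ closure of `𝒯₊(C)` in `𝓛(𝓕(E(C)))`. -/
def hardyAlgebra (C : Matrix V V ℕ∞) : Subalgebra ℂ (adjointable (V → ℂ) (Fock C)) :=
  wstarClosure (quiverAlgebra C)

theorem quiverAlgebra_le (C : Matrix V V ℕ∞) : quiverAlgebra C ≤ hardyAlgebra C :=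
  @Subalgebra.le_topologicalClosure ℂ _ _ (wstarTopology (V := V) (Fock C)) _ _
    semitopological_wstar _

theorem creation_mem (ξ : Corr C) : creation ξ ∈ quiverAlgebra C :=
  Subalgebra.le_topologicalClosure _ (Algebra.subset_adjoin (Or.inl ⟨ξ, rfl⟩))

end Fock

/-! ### The algebras of a single vertex with `m` loops -/

/-- The `1 × 1` matrix with entry `m`. -/
abbrev oneByOne (m : ℕ∞) : Matrix (Fin 1) (Fin 1) ℕ∞ := fun _ _ => m

/-- The noncommutative disc algebra `𝒜_m`. -/
abbrev discAlgebra (m : ℕ∞) := quiverAlgebra (oneByOne m)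

/-- The free semigroup algebra `ℒ_m`. -/
abbrev freeSemigroupAlgebra (m : ℕ∞) := hardyAlgebra (oneByOne m)

/-- The element of `E(C)` with `(i, i)` entry the vector `x ∈ ℂ^{C i i}` and all other entries
zero. -/
def loopVector {V : Type*} [Fintype V] [DecidableEq V] (C : Matrix V V ℕ∞) (i : V)
    (x : Corr (oneByOne (C i i))) : Corr C :=
  Pi.single i (WithLp.toLp 2 (Pi.single i (x 0 0)))

end QuiverAlgebra

/-! Every path of the quiver from `j` to `i` factors uniquely as `w q`, where `w` is a word in the
loops at `i` and the leftmost arrow of `q` is not such a loop (`factorization`).  Hence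
`φ_∞(e_i) 𝓕(E(C))`, whose `j`-th column has the paths from `j` to `i` as orthonormal basis, is the
direct sum, over the paths `q`, of copies of the Fock space of the `1 × 1` matrix `(C i i)`
(`component`, `hasSum_inner_component`).  The homomorphism is the amplification `S ↦ S ⊗ 1` along
this decomposition, extended by zero to the other rows.  It is a ⋆-homomorphism on all of
`𝓛(𝓕(E(C i i)))`, it takes `1` to `φ_∞(e_i)`, and it takes `T_x` to the creation operator of the
matrix with `(i, i)` entry `x`, because that operator prepends a loop at `i` to `w`
(`amplification_creation`).

The path of length `0` at `i` gives one component, contained in the `i`-th column; the compression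
to it is a left inverse of the amplification (`compression_amplification`).  So the amplification is
an injective ⋆-homomorphism, and these are completely isometric.  Both maps are weak-⋆ continuous:
a vector functional composed with the compression is a vector functional, and composed with the
amplification it is a norm convergent sum of vector functionals (`continuous_wstar_amplification`).
Therefore the amplification is an embedding for the weak-⋆ topologies.  It maps the generators of
the disc algebra into `𝒯₊(C)`, hence, by norm and weak-⋆ continuity, it maps the two closed algebras
into `𝒯₊(C)` and `H^∞(C)`. -/

namespace QuiverAlgebra

/-! ### Factorization of paths -/

section Paths

variable {V : Type*} [Fintype V] {C : Matrix V V ℕ∞} {i j : V}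

/-- The path `w q`: a word `w` in the loops at `i`, followed on its right by a path `q` that ends
at `i`. -/
def prependLoops : ∀ {a b : Fin 1}, QPath (oneByOne (C i i)) a b → QPath C i j → QPath C i j
  | _, _, .nil _, q => q
  | _, _, .cons e p, q => .cons (l := i) e (prependLoops p q)

/-- The paths from `j` to `i` whose leftmost arrow is not a loop at `i` (among them, for `j = i`,
the path of length `0`). -/
def LooplessPath (C : Matrix V V ℕ∞) (i j : V) : Type _ :=
  {q : QPath C i j // ∀ (e : EdgeIndex (C i i)) (p : QPath C i j), q ≠ .cons e p}

theorem prependLoops_injective {a b : Fin 1} (w w' : QPath (oneByOne (C i i)) a b)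
    (q q' : LooplessPath C i j) (h : prependLoops w q.1 = prependLoops w' q'.1) :
    w = w' ∧ q = q' := by
  induction w with
  | nil a =>
    cases w' with
    | nil => exact ⟨rfl, Subtype.ext h⟩
    | cons e p => exact absurd h (q.2 _ _)
  | @cons a l b e p ih =>
    cases w' with
    | nil => exact absurd h.symm (q'.2 _ _)
    | @cons _ l' _ e' p' =>
      obtain rfl : l = l' := Subsingleton.elim _ _
      simp only [prependLoops, PathOf.cons.injEq, heq_eq_eq, true_and] at h
      obtain ⟨h1, h2⟩ := h
      obtain ⟨h3, h4⟩ := ih p' h2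
      subst h1 h3
      exact ⟨rfl, h4⟩

theorem exists_prependLoops_eq {k : V} (p : QPath C k j) (hk : k = i) :
    ∃ (w : QPath (oneByOne (C i i)) 0 0) (q : LooplessPath C i j),
      hk ▸ p = prependLoops w q.1 := by
  induction p with
  | nil k =>
    subst hk
    exact ⟨.nil 0, ⟨.nil k, fun e p h => by cases h⟩, rfl⟩
  | @cons k l j e p ih =>
    subst hk
    by_cases hl : l = k
    · obtain ⟨w, q, h⟩ := ih hl
      subst hl
      exact ⟨.cons (l := (0 : Fin 1)) e w, q, congrArg (PathOf.cons e) h⟩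
    · refine ⟨.nil 0, ⟨.cons e p, fun e' p' h => hl ?_⟩, rfl⟩
      simp only [PathOf.cons.injEq] at h
      exact h.1

/-- Unique factorization of the paths from `j` to `i` as `w q`, with `w` a word in the loops at `i`
and `q` not beginning with such a loop. -/
def factorization (C : Matrix V V ℕ∞) (i j : V) :
    LooplessPath C i j × QPath (oneByOne (C i i)) 0 0 ≃ QPath C i j :=
  Equiv.ofBijective (fun x => prependLoops x.2 x.1.1)
    ⟨fun x y h => by
      obtain ⟨h1, h2⟩ := prependLoops_injective _ _ _ _ h
      exact Prod.ext h2 h1,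
    fun p => by
      obtain ⟨w, q, h⟩ := exists_prependLoops_eq p rfl
      exact ⟨(q, w), h.symm⟩⟩

end Paths

/-! ### Components of a column of the Fock space -/

section Restriction

variable {V : Type*} [Fintype V] {C : Matrix V V ℕ∞} {i j : V}

theorem norm_fock_oneByOne {m : ℕ∞} (x : Fock (oneByOne m)) : ‖x‖ = ‖x 0 0‖ := by
  have h : ‖x‖ = ‖x 0‖ := by
    refine le_antisymm ((pi_norm_le_iff_of_nonneg (norm_nonneg _)).2 fun k => ?_)
      (norm_le_pi_norm x 0)
    rw [Subsingleton.elim k 0]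
  rw [h, ← sq_eq_sq₀ (norm_nonneg _) (norm_nonneg _), PiLp.norm_sq_eq_of_L2]
  simp

theorem inner_fock_oneByOne {m : ℕ∞} (x y : Fock (oneByOne m)) :
    inner (Fin 1 → ℂ) x y 0 = inner ℂ (x 0 0) (y 0 0) := by
  change inner ℂ (x 0) (y 0) = _
  simp [PiLp.inner_apply]

/-- The component of a vector of the `j`-th column along `q`: writing the paths from `j` to `i` as
`w q` identifies the `(i, j)` entry of `𝓕(E(C))` with a direct sum, over the paths `q`, of copies
of the Fock space of the loops at `i`. -/
def component (q : LooplessPath C i j) :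
    Column (QPath C) j →ₗ[ℂ] Fock (oneByOne (C i i)) where
  toFun η := fun b => WithLp.toLp 2 fun a => ⟨fun w => η i (prependLoops w q.1), memℓp_gen (by
    have h : Function.Injective fun w : QPath (oneByOne (C i i)) a b => prependLoops w q.1 :=
      fun w w' h => (prependLoops_injective w w' q q h).1
    simpa [Function.comp_def] using (hasSum_sq (η i)).summable.comp_injective h)⟩
  map_add' _ _ := rfl
  map_smul' _ _ := rfl

theorem component_apply (q : LooplessPath C i j) (η : Column (QPath C) j) {a b : Fin 1}
    (w : QPath (oneByOne (C i i)) a b) : component q η b a w = η i (prependLoops w q.1) :=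
  rfl

theorem hasSum_inner_component (η ζ : Column (QPath C) j) :
    HasSum (fun q : LooplessPath C i j =>
      inner (Fin 1 → ℂ) (component q η) (component q ζ) 0) (inner ℂ (η i) (ζ i)) := by
  have h := (factorization C i j).hasSum_iff.2 (lp.hasSum_inner (𝕜 := ℂ) (η i) (ζ i))
  refine h.prod_fiberwise fun q => ?_
  rw [inner_fock_oneByOne]
  exact lp.hasSum_inner (𝕜 := ℂ) (component q η 0 0) (component q ζ 0 0)

theorem hasSum_norm_sq_component (η : Column (QPath C) j) :
    HasSum (fun q : LooplessPath C i j => ‖component q η‖ ^ 2) (‖η i‖ ^ 2) := by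
  have h := Complex.hasSum_re (hasSum_inner_component (i := i) η η)
  simp only [inner_fock_oneByOne, inner_self_eq_norm_sq_to_K] at h
  simp only [norm_fock_oneByOne]
  convert h using 1
  · ext q; norm_cast
  · norm_cast

theorem norm_component_le (q : LooplessPath C i j) (η : Column (QPath C) j) :
    ‖component q η‖ ≤ ‖η‖ := by
  refine (abs_le_of_sq_le_sq' ?_ (norm_nonneg _)).2.trans (PiLp.norm_apply_le η i)
  exact le_hasSum (hasSum_norm_sq_component η) q fun _ _ => sq_nonneg _

theorem summable_norm_component_mul (η ζ : Column (QPath C) j) :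
    Summable fun q : LooplessPath C i j => ‖component q η‖ * ‖component q ζ‖ := by
  refine Summable.of_nonneg_of_le (fun _ => by positivity) (fun q => ?_)
    ((hasSum_norm_sq_component η).summable.add (hasSum_norm_sq_component ζ).summable)
  nlinarith [sq_nonneg (‖component q η‖ - ‖component q ζ‖), sq_nonneg ‖component q η‖,
    sq_nonneg ‖component q ζ‖]

/-- The vector of the `(i, j)` entry of the Fock space with given components along the paths `q`.
-/
def glue (f : LooplessPath C i j → Fock (oneByOne (C i i))) (hf : Summable fun q => ‖f q‖ ^ 2) :
    lp (fun _ : QPath C i j => ℂ) 2 :=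
  ⟨fun p => f ((factorization C i j).symm p).1 0 0 ((factorization C i j).symm p).2, memℓp_gen (by
    have h : Summable fun x : LooplessPath C i j × QPath (oneByOne (C i i)) 0 0 =>
        ‖f x.1 0 0 x.2‖ ^ 2 := by
      refine (summable_prod_of_nonneg fun x => sq_nonneg _).2
        ⟨fun q => (hasSum_sq (f q 0 0)).summable, ?_⟩
      refine hf.congr fun q => ?_
      rw [(hasSum_sq (f q 0 0)).tsum_eq, norm_fock_oneByOne]
    simpa [Function.comp_def] using (factorization C i j).symm.summable_iff.2 h)⟩

theorem glue_prependLoops (f : LooplessPath C i j → Fock (oneByOne (C i i)))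
    (hf : Summable fun q => ‖f q‖ ^ 2) (w : QPath (oneByOne (C i i)) 0 0)
    (q : LooplessPath C i j) : glue f hf (prependLoops w q.1) = f q 0 0 w := by
  have h : (factorization C i j).symm (prependLoops w q.1) = (q, w) :=
    (factorization C i j).symm_apply_apply (q, w)
  change f ((factorization C i j).symm (prependLoops w q.1)).1 0 0
    ((factorization C i j).symm (prependLoops w q.1)).2 = _
  rw [h]

variable [DecidableEq V]

/-- The vector of the `j`-th column with given components along the paths `q` in row `i`, and with
zero in all other rows. -/
def glueColumn (f : LooplessPath C i j → Fock (oneByOne (C i i)))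
    (hf : Summable fun q => ‖f q‖ ^ 2) : Column (QPath C) j :=
  WithLp.toLp 2 (Pi.single i (glue f hf))

theorem component_glueColumn (f : LooplessPath C i j → Fock (oneByOne (C i i)))
    (hf : Summable fun q => ‖f q‖ ^ 2) (q : LooplessPath C i j) :
    component q (glueColumn f hf) = f q := by
  ext b a w
  obtain rfl : b = 0 := Subsingleton.elim _ _
  obtain rfl : a = 0 := Subsingleton.elim _ _
  rw [component_apply, ← glue_prependLoops f hf w q]
  simp [glueColumn]

theorem glueColumn_of_ne {k : V} (hk : k ≠ i) (f : LooplessPath C i j → Fock (oneByOne (C i i)))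
    (hf : Summable fun q => ‖f q‖ ^ 2) : glueColumn f hf k = 0 := by
  simp [glueColumn, hk]

/-- A vector of a column is determined by its components in row `i` and by its other rows. -/
theorem column_ext (i : V) {η ζ : Column (QPath C) j}
    (h : ∀ q : LooplessPath C i j, component q η = component q ζ) (h' : ∀ k ≠ i, η k = ζ k) :
    η = ζ := by
  ext k p
  by_cases hk : k = i
  · subst hk
    obtain ⟨⟨q, w⟩, rfl⟩ := (factorization C k j).surjective p
    have := congrArg (fun x : Fock (oneByOne (C k k)) => x 0 0 w) (h q)
    exact this
  · rw [h' k hk]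

end Restriction

/-! ### The amplification -/

section Amplification

variable {V : Type*} [Fintype V] [DecidableEq V] {C : Matrix V V ℕ∞} {i j : V}

theorem norm_glueColumn (f : LooplessPath C i j → Fock (oneByOne (C i i)))
    (hf : Summable fun q => ‖f q‖ ^ 2) : ‖glueColumn f hf‖ ^ 2 = ∑' q, ‖f q‖ ^ 2 := by
  have h := hasSum_norm_sq_component (i := i) (glueColumn f hf)
  simp only [component_glueColumn] at h
  rw [h.tsum_eq, PiLp.norm_sq_eq_of_L2]
  refine Finset.sum_eq_single i (fun k _ hk => ?_) (by simp)
  simp [glueColumn_of_ne hk]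

theorem inner_glueColumn (f : LooplessPath C i j → Fock (oneByOne (C i i)))
    (hf : Summable fun q => ‖f q‖ ^ 2) (ζ : Column (QPath C) j) :
    HasSum (fun q => inner (Fin 1 → ℂ) (component q ζ) (f q) 0)
      (inner ℂ ζ (glueColumn f hf)) := by
  have h := hasSum_inner_component (i := i) ζ (glueColumn f hf)
  simp only [component_glueColumn] at h
  convert h using 1
  rw [PiLp.inner_apply]
  refine Finset.sum_eq_single i (fun k _ hk => ?_) (by simp)
  simp [glueColumn_of_ne hk]

theorem norm_sq_apply_component_le (S : adjointable (Fin 1 → ℂ) (Fock (oneByOne (C i i))))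
    (η : Column (QPath C) j) (q : LooplessPath C i j) :
    ‖S.1 (component q η)‖ ^ 2 ≤ ‖S‖ ^ 2 * ‖component q η‖ ^ 2 := by
  rw [← mul_pow]
  gcongr
  exact S.1.le_opNorm _

theorem summable_apply_component (S : adjointable (Fin 1 → ℂ) (Fock (oneByOne (C i i))))
    (η : Column (QPath C) j) :
    Summable fun q : LooplessPath C i j => ‖S.1 (component q η)‖ ^ 2 :=
  Summable.of_nonneg_of_le (fun _ => sq_nonneg _) (norm_sq_apply_component_le S η)
    ((hasSum_norm_sq_component η).summable.mul_left _)

/-- The action of `S` on each component of a vector of the `j`-th column in row `i`, and of zero on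
the other rows. -/
def amplificationColumn (j : V) (S : adjointable (Fin 1 → ℂ) (Fock (oneByOne (C i i)))) :
    Column (QPath C) j →L[ℂ] Column (QPath C) j :=
  LinearMap.mkContinuous
    { toFun := fun η => glueColumn (fun q => S.1 (component q η)) (summable_apply_component S η)
      map_add' := fun η ζ => column_ext i (fun q => by simp [component_glueColumn])
        fun k hk => by simp [glueColumn_of_ne hk]
      map_smul' := fun c η => column_ext i (fun q => by simp [component_glueColumn])
        fun k hk => by simp [glueColumn_of_ne hk] }
    ‖S‖ fun η => by
      refine (abs_le_of_sq_le_sq' ?_ (by positivity)).2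
      have h := hasSum_norm_sq_component (i := i) η
      calc _ = ∑' q, ‖S.1 (component q η)‖ ^ 2 := norm_glueColumn _ _
        _ ≤ ∑' q, ‖S‖ ^ 2 * ‖component q η‖ ^ 2 :=
          (summable_apply_component S η).tsum_le_tsum (norm_sq_apply_component_le S η)
            (h.summable.mul_left _)
        _ = ‖S‖ ^ 2 * ‖η i‖ ^ 2 := by rw [tsum_mul_left, h.tsum_eq]
        _ ≤ (‖S‖ * ‖η‖) ^ 2 := by
          rw [mul_pow]
          gcongr
          exact PiLp.norm_apply_le η i

theorem component_amplificationColumn (S : adjointable (Fin 1 → ℂ) (Fock (oneByOne (C i i))))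
    (η : Column (QPath C) j) (q : LooplessPath C i j) :
    component q (amplificationColumn j S η) = S.1 (component q η) :=
  component_glueColumn _ _ q

theorem amplificationColumn_of_ne (S : adjointable (Fin 1 → ℂ) (Fock (oneByOne (C i i))))
    (η : Column (QPath C) j) {k : V} (hk : k ≠ i) : amplificationColumn j S η k = 0 :=
  glueColumn_of_ne hk _ _

theorem hasSum_inner_amplificationColumn
    (S : adjointable (Fin 1 → ℂ) (Fock (oneByOne (C i i)))) (ζ η : Column (QPath C) j) :
    HasSum (fun q : LooplessPath C i j =>
      inner (Fin 1 → ℂ) (component q ζ) (S.1 (component q η)) 0)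
      (inner ℂ ζ (amplificationColumn j S η)) :=
  inner_glueColumn _ _ ζ

/-- The ⋆-homomorphism `S ↦ S ⊗ 1` from `𝓛(𝓕(E(C i i)))` to `𝓛(𝓕(E(C)))`, where `φ_∞(e_i) 𝓕(E(C))`
is seen as the direct sum of the components along the paths `q`.  It takes the unit to
`φ_∞(e_i)`. -/
def amplification (C : Matrix V V ℕ∞) (i : V) :
    adjointable (Fin 1 → ℂ) (Fock (oneByOne (C i i))) →⋆ₙₐ[ℂ] adjointable (V → ℂ) (Fock C) where
  toFun S := ofColumns fun j => amplificationColumn j S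
  map_smul' c S := by
    ext η : 2
    funext j
    refine column_ext i (fun q => ?_) fun k hk => ?_
    · change component q (amplificationColumn j (c • S) (η j)) =
        component q (c • amplificationColumn j S (η j))
      rw [map_smul, component_amplificationColumn, component_amplificationColumn]
      rfl
    · change amplificationColumn j (c • S) (η j) k = c • amplificationColumn j S (η j) k
      rw [amplificationColumn_of_ne _ _ hk, amplificationColumn_of_ne _ _ hk, smul_zero]
  map_zero' := by
    ext η : 2
    funext j
    refine column_ext i (fun q => ?_) fun k hk => amplificationColumn_of_ne _ _ hk
    exact component_amplificationColumn 0 (η j) q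
  map_add' S T := by
    ext η : 2
    funext j
    refine column_ext i (fun q => ?_) fun k hk => ?_
    · change component q (amplificationColumn j (S + T) (η j)) =
        component q (amplificationColumn j S (η j) + amplificationColumn j T (η j))
      rw [map_add, component_amplificationColumn, component_amplificationColumn,
        component_amplificationColumn]
      rfl
    · change amplificationColumn j (S + T) (η j) k =
        amplificationColumn j S (η j) k + amplificationColumn j T (η j) k
      simp only [amplificationColumn_of_ne _ _ hk, add_zero]
  map_mul' S T := by
    ext η : 2
    funext j
    refine column_ext i (fun q => ?_) fun k hk => ?_
    · change component q (amplificationColumn j (S * T) (η j)) =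
        component q (amplificationColumn j S (amplificationColumn j T (η j)))
      simp only [component_amplificationColumn]
      rfl
    · change amplificationColumn j (S * T) (η j) k =
        amplificationColumn j S (amplificationColumn j T (η j)) k
      simp only [amplificationColumn_of_ne _ _ hk]
  map_star' S := by
    refine (adjointable.star_eq_of fun x y => ?_).symm
    funext j
    change inner ℂ (amplificationColumn j S (x j)) (y j) =
      inner ℂ (x j) (amplificationColumn j (star S) (y j))
    have h1 := Complex.hasSum_conj'.2 (hasSum_inner_amplificationColumn S (y j) (x j))
    rw [inner_conj_symm] at h1
    refine h1.unique ?_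
    convert hasSum_inner_amplificationColumn (star S) (x j) (y j) using 2 with q
    rw [← adjointable.inner_left, ← CStarModule.star_inner]
    simp

theorem amplification_smul (c : ℂ) (S : adjointable (Fin 1 → ℂ) (Fock (oneByOne (C i i)))) :
    amplification C i (c • S) = c • amplification C i S :=
  (amplification C i).map_smul' c S

theorem amplification_zero : amplification C i 0 = 0 :=
  (amplification C i).map_zero'

theorem amplification_add (S T : adjointable (Fin 1 → ℂ) (Fock (oneByOne (C i i)))) :
    amplification C i (S + T) = amplification C i S + amplification C i T :=
  (amplification C i).map_add' S T

theorem amplification_mul (S T : adjointable (Fin 1 → ℂ) (Fock (oneByOne (C i i)))) :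
    amplification C i (S * T) = amplification C i S * amplification C i T :=
  (amplification C i).map_mul' S T

theorem component_amplification (S : adjointable (Fin 1 → ℂ) (Fock (oneByOne (C i i))))
    (η : Fock C) (q : LooplessPath C i j) :
    component q ((amplification C i S).1 η j) = S.1 (component q (η j)) :=
  component_amplificationColumn S (η j) q

theorem amplification_of_ne (S : adjointable (Fin 1 → ℂ) (Fock (oneByOne (C i i))))
    (η : Fock C) {k : V} (hk : k ≠ i) : (amplification C i S).1 η j k = 0 :=
  amplificationColumn_of_ne S (η j) hk

theorem amplification_one : amplification C i 1 = leftAction C (Pi.single i 1) := by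
  ext η : 2
  funext j
  have h : ∀ k, (leftAction C (Pi.single i 1)).1 η j k = (Pi.single i (1 : ℂ) : V → ℂ) k • η j k :=
    fun k => rfl
  refine column_ext i (fun q => ?_) fun k hk => ?_
  · rw [component_amplification]
    ext b a w
    change η j i (prependLoops w q.1) = (leftAction C (Pi.single i 1)).1 η j i (prependLoops w q.1)
    rw [h]
    simp
  · rw [amplification_of_ne _ _ hk, h]
    simp [hk]

/-- On a word `w = e w'` both sides prepend the loop `e` to `w' q`.  On the empty word the left side
is zero, and so is the right, since the leftmost arrow of `q` is not a loop at `i`. -/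
theorem amplification_creation (x : Corr (oneByOne (C i i))) :
    amplification C i (creation x) = creation (loopVector C i x) := by
  ext η : 2
  funext j
  refine column_ext i (fun q => ?_) fun k hk => ?_
  · rw [component_amplification]
    ext b a w
    cases w with
    | nil =>
      change 0 = tensorCoord (loopVector C i x) (η j) i q.1
      obtain ⟨q, hq⟩ := q
      cases q with
      | nil => rfl
      | @cons _ l _ e p =>
        have hl : l ≠ i := by
          rintro rfl
          exact hq e p rfl
        simp [tensorCoord, loopVector, hl]
    | @cons _ l _ e w =>
      change x l a e * η j i (prependLoops w q.1) =
        loopVector C i x i i e * η j i (prependLoops w q.1)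
      obtain rfl : l = 0 := Subsingleton.elim _ _
      obtain rfl : a = 0 := Subsingleton.elim _ _
      simp [loopVector]
  · rw [amplification_of_ne _ _ hk]
    ext p
    cases p with
    | nil => rfl
    | @cons _ l _ e p =>
      change 0 = loopVector C i x l k e * η j l p
      by_cases hl : l = i
      · subst hl
        simp [loopVector, hk]
      · simp [loopVector, hl]

end Amplification

/-! ### Weak-⋆ continuity of maps between algebras of adjointable operators -/

section WeakStarMaps

variable {V W : Type*} [Fintype V] [Fintype W]
  {E F : Type*} [NormedAddCommGroup E] [NormedSpace ℂ E] [SMul (V → ℂ) E] [CStarModule (V → ℂ) E]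
  [NormedAddCommGroup F] [NormedSpace ℂ F] [SMul (W → ℂ) F] [CStarModule (W → ℂ) F]

/-- The functional `T ↦ ⟪x, T y⟫_j`. -/
def vectorFunctional (j : V) (x y : E) : StrongDual ℂ (adjointable (V → ℂ) E) :=
  LinearMap.mkContinuous
    { toFun := fun T => inner (V → ℂ) x (T.1 y) j
      map_add' := fun S T => by
        change inner (V → ℂ) x (S.1 y + T.1 y) j = _
        rw [CStarModule.inner_add_right]; rfl
      map_smul' := fun c T => by
        change inner (V → ℂ) x (c • T.1 y) j = _
        rw [CStarModule.inner_smul_right_complex]; rfl }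
    (‖x‖ * ‖y‖) fun T => by
      calc ‖inner (V → ℂ) x (T.1 y) j‖ ≤ ‖inner (V → ℂ) x (T.1 y)‖ := norm_le_pi_norm _ j
        _ ≤ ‖x‖ * ‖T.1 y‖ := CStarModule.norm_inner_le E
        _ ≤ ‖x‖ * (‖T‖ * ‖y‖) := by gcongr; exact T.1.le_opNorm y
        _ = ‖x‖ * ‖y‖ * ‖T‖ := by ring

theorem norm_vectorFunctional_le (j : V) (x y : E) :
    ‖vectorFunctional (E := E) j x y‖ ≤ ‖x‖ * ‖y‖ :=
  LinearMap.mkContinuous_norm_le _ (by positivity) _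

theorem vectorFunctional_mem (j : V) (x y : E) : vectorFunctional j x y ∈ predual (V := V) E :=
  Submodule.le_topologicalClosure _ (Submodule.subset_span ⟨j, x, y, fun _ => rfl⟩)

/-- A bounded linear map that pulls the vector functionals back into the predual is continuous for
the weak-⋆ topologies: since it is bounded, it then pulls back the whole predual. -/
theorem continuous_wstar_of_comp_mem (Φ : adjointable (V → ℂ) E →L[ℂ] adjointable (W → ℂ) F)
    (h : ∀ (j : W) (x y : F), (vectorFunctional j x y).comp Φ ∈ predual (V := V) E) :
    @Continuous _ _ (wstarTopology (V := V) E) (wstarTopology (V := W) F) (fun T => Φ T) := by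
  let R : StrongDual ℂ (adjointable (W → ℂ) F) →L[ℂ] StrongDual ℂ (adjointable (V → ℂ) E) :=
    (ContinuousLinearMap.compL ℂ (adjointable (V → ℂ) E) (adjointable (W → ℂ) F) ℂ).flip Φ
  have hR : predual (V := W) F ≤ (predual (V := V) E).comap R.toLinearMap := by
    refine Submodule.topologicalClosure_minimal _ (Submodule.span_le.2 ?_)
      ((Submodule.isClosed_topologicalClosure _).preimage R.continuous)
    rintro ω ⟨j, x, y, hω⟩
    obtain rfl : ω = vectorFunctional j x y := ContinuousLinearMap.ext hω
    exact h j x y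
  refine continuous_induced_rng.2 (@continuous_pi _ _ _ (wstarTopology (V := V) E) _ _ fun ω => ?_)
  have h2 : @Continuous _ _ (wstarTopology (V := V) E) _
      fun T (ω : predual (V := V) E) => ω.1 T := continuous_induced_dom
  let ω' : predual (V := V) E := ⟨ω.1.comp Φ, hR ω.2⟩
  have h3 := @Continuous.comp _ _ _ (wstarTopology (V := V) E) _ _ _ _ (continuous_apply ω') h2
  exact h3

end WeakStarMaps

/-! ### The compression to the Fock space of the loops -/

section Compression

variable {V : Type*} [Fintype V] [DecidableEq V] {C : Matrix V V ℕ∞} {i : V}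

/-- The path of length `0` at `i`, as a path that does not begin with a loop. -/
def nilPath (C : Matrix V V ℕ∞) (i : V) : LooplessPath C i i :=
  ⟨.nil i, fun _ _ h => by cases h⟩

/-- `component` as a bounded operator. -/
def componentL {j : V} (q : LooplessPath C i j) :
    Column (QPath C) j →L[ℂ] Fock (oneByOne (C i i)) :=
  (component q).mkContinuous 1 fun η => by simpa using norm_component_le q η

theorem summable_norm_sq_single [DecidableEq (LooplessPath C i i)] (q : LooplessPath C i i)
    (f : Fock (oneByOne (C i i))) :
    Summable fun q' => ‖(Pi.single q f : LooplessPath C i i → Fock (oneByOne (C i i))) q'‖ ^ 2 := by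
  refine summable_of_ne_finset_zero (s := {q}) fun q' hq => ?_
  have : q' ≠ q := by simpa using hq
  simp [this]

open scoped Classical in
/-- The inclusion of the Fock space of the loops at `i` into the `i`-th column of `𝓕(E(C))`, as the
component along the path of length `0`. -/
def loopInclusion (C : Matrix V V ℕ∞) (i : V) :
    Fock (oneByOne (C i i)) →L[ℂ] Column (QPath C) i :=
  LinearMap.mkContinuous
    { toFun := fun f => glueColumn (Pi.single (nilPath C i) f) (summable_norm_sq_single _ f)
      map_add' := fun f g => column_ext i
        (fun q => by simp [component_glueColumn, Pi.single_add]) fun k hk => by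
          simp [glueColumn_of_ne hk]
      map_smul' := fun c f => column_ext i
        (fun q => by simp [component_glueColumn, Pi.single_smul]) fun k hk => by
          simp [glueColumn_of_ne hk] }
    1 fun f => by
      refine (abs_le_of_sq_le_sq' ?_ (by positivity)).2
      refine (norm_glueColumn _ _).trans_le ?_
      rw [tsum_eq_single (nilPath C i) fun q hq => by simp [hq]]
      simp

theorem component_loopInclusion (f : Fock (oneByOne (C i i))) :
    component (nilPath C i) (loopInclusion C i f) = f := by
  classical
  refine (component_glueColumn _ _ _).trans ?_
  simp

theorem inner_loopInclusion (f : Fock (oneByOne (C i i))) (ζ : Column (QPath C) i) :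
    inner ℂ (loopInclusion C i f) ζ = inner (Fin 1 → ℂ) f (component (nilPath C i) ζ) 0 := by
  classical
  have h := inner_glueColumn _ (summable_norm_sq_single (nilPath C i) f) ζ
  have h' := h.unique (hasSum_single (nilPath C i) fun q hq => by simp [hq])
  rw [Pi.single_eq_same] at h'
  have h'' : inner ℂ ζ (loopInclusion C i f) = _ := h'
  rw [← inner_conj_symm, h'', ← CStarModule.star_inner]
  simp

/-- The module has a single column, so a bounded operator on it is one on a Hilbert space. -/
theorem mem_adjointable_fock_oneByOne {m : ℕ∞}
    (T : Fock (oneByOne m) →L[ℂ] Fock (oneByOne m)) : T ∈ adjointable (Fin 1 → ℂ) _ := by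
  let T' : adjointable (Fin 1 → ℂ) (Fock (oneByOne m)) := ofColumns fun j =>
    ContinuousLinearMap.proj j ∘L T ∘L ContinuousLinearMap.single ℂ (Column (QPath (oneByOne m))) j
  have h : T'.1 = T := by
    ext x : 1
    funext j
    change T (Pi.single j (x j)) j = T x j
    have hx : (Pi.single j (x j) : Fock (oneByOne m)) = x := by
      funext k
      obtain rfl : k = j := Subsingleton.elim _ _
      simp
    rw [hx]
  exact h ▸ T'.2

/-- The compression of an operator on `𝓕(E(C))` to the Fock space of the loops at `i`. -/
def compression (C : Matrix V V ℕ∞) (i : V) :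
    adjointable (V → ℂ) (Fock C) →L[ℂ] adjointable (Fin 1 → ℂ) (Fock (oneByOne (C i i))) :=
  let P : Fock C →L[ℂ] Fock (oneByOne (C i i)) :=
    componentL (nilPath C i) ∘L ContinuousLinearMap.proj i
  let Q : Fock (oneByOne (C i i)) →L[ℂ] Fock C :=
    ContinuousLinearMap.single ℂ (Column (QPath C)) i ∘L loopInclusion C i
  LinearMap.mkContinuous
    { toFun := fun T => ⟨P ∘L T.1 ∘L Q, mem_adjointable_fock_oneByOne _⟩
      map_add' := fun S T => Subtype.ext (by ext x : 1; exact map_add P _ _)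
      map_smul' := fun c T => Subtype.ext (by ext x : 1; exact map_smul P _ _) }
    (‖P‖ * ‖Q‖) fun T => by
      calc ‖P ∘L T.1 ∘L Q‖ ≤ ‖P‖ * (‖T.1‖ * ‖Q‖) :=
            (P.opNorm_comp_le _).trans (by gcongr; exact T.1.opNorm_comp_le Q)
        _ = ‖P‖ * ‖Q‖ * ‖T‖ := by rw [mul_comm ‖T.1‖, mul_assoc]; rfl

theorem compression_apply (T : adjointable (V → ℂ) (Fock C)) (f : Fock (oneByOne (C i i))) :
    (compression C i T).1 f =
      component (nilPath C i) (T.1 (Pi.single i (loopInclusion C i f)) i) := rfl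

theorem compression_amplification (S : adjointable (Fin 1 → ℂ) (Fock (oneByOne (C i i)))) :
    compression C i (amplification C i S) = S := by
  ext f : 2
  rw [compression_apply, component_amplification, Pi.single_eq_same, component_loopInclusion]

theorem continuous_wstar_compression :
    @Continuous _ _ (wstarTopology (V := V) (Fock C))
      (wstarTopology (V := Fin 1) (Fock (oneByOne (C i i)))) (compression C i) := by
  refine continuous_wstar_of_comp_mem _ fun j x y => ?_
  obtain rfl : j = 0 := Subsingleton.elim _ _
  convert vectorFunctional_mem (V := V) i (Pi.single i (loopInclusion C i x) : Fock C)
    (Pi.single i (loopInclusion C i y) : Fock C) using 1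
  ext T
  change inner (Fin 1 → ℂ) x ((compression C i T).1 y) 0 =
    inner ℂ ((Pi.single i (loopInclusion C i x) : Fock C) i) _
  rw [Pi.single_eq_same, inner_loopInclusion, compression_apply]

end Compression

/-! ### Injective ⋆-homomorphisms of C⋆-algebras -/

section StarHom

variable {A B : Type*} [CStarAlgebra A] [CStarAlgebra B]

theorem continuous_of_injective (φ : A →⋆ₙₐ[ℂ] B) (h : Function.Injective φ) : Continuous φ :=
  (NonUnitalStarAlgHom.isometry φ h).continuous

/-- Entrywise, an injective ⋆-homomorphism of C⋆-algebras is an injective ⋆-homomorphism of the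
C⋆-algebras of matrices, hence isometric. -/
theorem norm_ofMatrix_map [PartialOrder A] [StarOrderedRing A] [PartialOrder B] [StarOrderedRing B]
    (φ : A →⋆ₙₐ[ℂ] B) (h : Function.Injective φ) {k : ℕ} (M : Matrix (Fin k) (Fin k) A) :
    ‖CStarMatrix.ofMatrix (M.map φ)‖ = ‖CStarMatrix.ofMatrix M‖ :=
  NonUnitalStarAlgHom.norm_map (CStarMatrix.mapₙₐ (n := Fin k) φ) (CStarMatrix.map_injective h)
    (CStarMatrix.ofMatrix M)

end StarHom

/-! ### Isometry, weak-⋆ continuity and restriction to the quiver algebras -/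

section Embedding

variable {V : Type*} [Fintype V] [DecidableEq V] {C : Matrix V V ℕ∞} {i : V}

theorem amplification_injective : Function.Injective (amplification C i) :=
  Function.LeftInverse.injective (g := compression C i) compression_amplification

theorem continuous_amplification : Continuous (amplification C i) :=
  continuous_of_injective (amplification C i) amplification_injective

/-- `amplification` as a bounded operator. -/
def amplificationL (C : Matrix V V ℕ∞) (i : V) :
    adjointable (Fin 1 → ℂ) (Fock (oneByOne (C i i))) →L[ℂ] adjointable (V → ℂ) (Fock C) where
  toFun := amplification C i
  map_add' := amplification_add
  map_smul' := amplification_smul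
  cont := continuous_amplification

/-- A vector functional of `S ⊗ 1` is the norm convergent sum of the vector functionals of `S` given
by the components of its two vectors. -/
theorem continuous_wstar_amplification :
    @Continuous _ _ (wstarTopology (V := Fin 1) (Fock (oneByOne (C i i))))
      (wstarTopology (V := V) (Fock C)) (amplification C i) := by
  refine continuous_wstar_of_comp_mem (amplificationL C i) fun j x y => ?_
  let ω : LooplessPath C i j → StrongDual ℂ
      (adjointable (Fin 1 → ℂ) (Fock (oneByOne (C i i)))) := fun q =>
    vectorFunctional 0 (component q (x j)) (component q (y j))
  have hω : Summable ω := Summable.of_norm_bounded (summable_norm_component_mul (x j) (y j))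
    fun q => norm_vectorFunctional_le _ _ _
  have h : (vectorFunctional j x y).comp (amplificationL C i) = ∑' q, ω q := by
    ext S
    have h1 := hω.hasSum.mapL (ContinuousLinearMap.apply ℂ ℂ S)
    exact (hasSum_inner_amplificationColumn S (x j) (y j)).unique h1
  rw [h]
  refine (Submodule.isClosed_topologicalClosure _).mem_of_tendsto hω.hasSum
    (Filter.Eventually.of_forall fun s => ?_)
  exact Submodule.sum_mem _ fun q _ => vectorFunctional_mem _ _ _

theorem isEmbedding_wstar_amplification :
    @Topology.IsEmbedding _ _ (wstarTopology (V := Fin 1) (Fock (oneByOne (C i i))))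
      (wstarTopology (V := V) (Fock C)) (amplification C i) :=
  @Topology.IsEmbedding.of_leftInverse _ _ (wstarTopology (V := V) (Fock C))
    (wstarTopology (V := Fin 1) (Fock (oneByOne (C i i)))) (compression C i) (amplification C i)
    compression_amplification continuous_wstar_compression continuous_wstar_amplification

theorem amplification_mem_adjoin {S : adjointable (Fin 1 → ℂ) (Fock (oneByOne (C i i)))}
    (hS : S ∈ Algebra.adjoin ℂ (Set.range (creation (C := oneByOne (C i i))) ∪
      Set.range (leftAction (oneByOne (C i i))))) :
    amplification C i S ∈
      Algebra.adjoin ℂ (Set.range (creation (C := C)) ∪ Set.range (leftAction C)) := by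
  have h1 : ∀ c : ℂ, amplification C i (algebraMap ℂ _ c) ∈
      Algebra.adjoin ℂ (Set.range (creation (C := C)) ∪ Set.range (leftAction C)) := fun c => by
    rw [Algebra.algebraMap_eq_smul_one, amplification_smul, amplification_one]
    have h : leftAction C (Pi.single i 1) ∈
        Algebra.adjoin ℂ (Set.range (creation (C := C)) ∪ Set.range (leftAction C)) :=
      Algebra.subset_adjoin (Or.inr ⟨_, rfl⟩)
    exact Subalgebra.smul_mem _ h c
  induction hS using Algebra.adjoin_induction with
  | mem S hS =>
    rcases hS with ⟨x, rfl⟩ | ⟨D, rfl⟩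
    · rw [amplification_creation]
      exact Algebra.subset_adjoin (Or.inl ⟨_, rfl⟩)
    · -- The diagonal algebra of a single vertex consists of the scalars.
      have h : leftAction (oneByOne (C i i)) D = algebraMap ℂ _ (D 0) := by
        ext x b a w
        obtain rfl : a = 0 := Subsingleton.elim _ _
        rfl
      rw [h]
      exact h1 _
  | algebraMap c => exact h1 c
  | add S T _ _ hS hT => rw [amplification_add]; exact add_mem hS hT
  | mul S T _ _ hS hT => rw [amplification_mul]; exact mul_mem hS hT

theorem amplification_mem_quiverAlgebra
    {S : adjointable (Fin 1 → ℂ) (Fock (oneByOne (C i i)))} (hS : S ∈ discAlgebra (C i i)) :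
    amplification C i S ∈ quiverAlgebra C :=
  map_mem_closure continuous_amplification hS fun _ => amplification_mem_adjoin

theorem amplification_mem_hardyAlgebra
    {S : adjointable (Fin 1 → ℂ) (Fock (oneByOne (C i i)))}
    (hS : S ∈ freeSemigroupAlgebra (C i i)) : amplification C i S ∈ hardyAlgebra C :=
  @map_mem_closure _ _ (wstarTopology (V := Fin 1) (Fock (oneByOne (C i i))))
    (wstarTopology (V := V) (Fock C)) _ _ _ _ continuous_wstar_amplification hS
    fun _ => amplification_mem_quiverAlgebra

/-- The restriction of `amplification` to a map between two subalgebras. -/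
def amplificationOn (B : Subalgebra ℂ (adjointable (Fin 1 → ℂ) (Fock (oneByOne (C i i)))))
    (B' : Subalgebra ℂ (adjointable (V → ℂ) (Fock C)))
    (h : ∀ S ∈ B, amplification C i S ∈ B') : B →ₙₐ[ℂ] B' where
  toFun S := ⟨amplification C i S, h S S.2⟩
  map_smul' c S := Subtype.ext (amplification_smul c S.1)
  map_zero' := Subtype.ext amplification_zero
  map_add' S T := Subtype.ext (amplification_add S.1 T.1)
  map_mul' S T := Subtype.ext (amplification_mul S.1 T.1)

theorem completelyIsometric_amplificationOn
    (B : Subalgebra ℂ (adjointable (Fin 1 → ℂ) (Fock (oneByOne (C i i)))))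
    (B' : Subalgebra ℂ (adjointable (V → ℂ) (Fock C)))
    (h : ∀ S ∈ B, amplification C i S ∈ B') : CompletelyIsometric (amplificationOn B B' h) :=
  fun _ M => norm_ofMatrix_map (amplification C i) amplification_injective (M.map fun S => S.1)

end Embedding

end QuiverAlgebra

open QuiverAlgebra in
theorem proposition3p1 (n : ℕ) (C : Matrix (Fin n) (Fin n) ℕ∞) (i : Fin n) (hi : C i i ≠ 0) :
    ∃ (Ψ : freeSemigroupAlgebra (C i i) →ₙₐ[ℂ] hardyAlgebra C)
      (Ψ₀ : discAlgebra (C i i) →ₙₐ[ℂ] quiverAlgebra C),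
      CompletelyIsometric Ψ ∧
      @Topology.IsEmbedding _ _ (wstarTopologyOn (freeSemigroupAlgebra (C i i)))
        (wstarTopologyOn (hardyAlgebra C)) Ψ ∧
      CompletelyIsometric Ψ₀ ∧
      (∀ S : discAlgebra (C i i),
        Ψ (Subalgebra.inclusion (quiverAlgebra_le _) S) =
          Subalgebra.inclusion (quiverAlgebra_le C) (Ψ₀ S)) ∧
      (Ψ 1 : adjointable (Fin n → ℂ) (Fock C)) = leftAction C (Pi.single i 1) ∧
      (∀ x : Corr (oneByOne (C i i)),
        (Ψ₀ ⟨creation x, creation_mem x⟩ : adjointable (Fin n → ℂ) (Fock C)) =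
          creation (loopVector C i x)) := by
  refine ⟨amplificationOn _ _ fun _ => amplification_mem_hardyAlgebra,
    amplificationOn _ _ fun _ => amplification_mem_quiverAlgebra,
    completelyIsometric_amplificationOn _ _ _, ?_, completelyIsometric_amplificationOn _ _ _,
    fun S => rfl, amplification_one, fun x => amplification_creation x⟩
  exact @Topology.IsEmbedding.restrict _ _ (wstarTopology (V := Fin 1) (Fock (oneByOne (C i i))))
    (wstarTopology (V := Fin n) (Fock C)) _ isEmbedding_wstar_amplification _ _
    fun _ => amplification_mem_hardyAlgebra
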